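/- **Setting.** Let $\mathcal X$ be a measurable space with a total order $\le$ and let $\varphi:\mathcal X\to\mathcal H$ be a map into a real Hilbert space, such that $(x,x')\mapsto\|\varphi(x)-\varphi(x')\|$ is measurable on $\mathcal X\times\mathcal X$ and $\{(x,x'):x\le x'\}$ is a measurable subset of $\mathcal X\times\mathcal X$. Examples are pairs $(x,y)\in\mathcal X\times\{-1,1\}$. Fix an integer $d\ge 1$ and an initial example $(\bar x,\bar y)$. **Guaranteed Error Machine (GEM).** Given a finite multiset $S$ of examples, put $P:=S\cup\{(\bar x,\bar y)\}$ (multiplicities are added), $C:=\emptyset$, $(x_C,y_C):=(\bar x,\bar y)$, $q:=0$, and repeat the following pass. 1. Let $q:=q+1$ and let $r^*\in[0,+\infty]$ be the largest $r$ such that $\|\varphi(x_i)-\varphi(x_C)\|\ge r$ for all $(x_i,y_i)\in P$ with $y_i\ne y_C$ ($r^*=+\infty$ if there is no such example). 2. Let $\mathcal R_q:=\{x\in\mathcal X:\|\varphi(x)-\varphi(x_C)\|<r^*\}$ and $\ell_q:=y_C$. If $r^*>0$, remove from $P$ all the examples with $x_i\in\mathcal R_q$; if $r^*=0$, remove from $P$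 one copy of $(x_C,y_C)$. 3. If $r^*<+\infty$, let $(x_{i^*},y_{i^*})$ be the example of $P$ with $\|\varphi(x_{i^*})-\varphi(x_C)\|=r^*$, $y_{i^*}\ne y_C$ and $x_{i^*}$ smallest among all the examples of $P$ with these two properties; add one copy of it to the multiset $C$ and let $(x_C,y_C):=(x_{i^*},y_{i^*})$. 4. If $|C|=d$ or $P=\emptyset$, stop; otherwise start a new pass. The GEM predictor is $\mathcal A(S):\mathcal X\to\{-1,0,1\}$, where $\mathcal A(S)(x)=\ell_{j}$ for the smallest $j\in\{1,\dots,q\}$ with $x\in\mathcal R_j$, and $\mathcal A(S)(x)=0$ if there is no such $j$. The compression of $S$ is the final multiset $\mathsf c(S)=C$. (So $|\mathsf c(S)|$ counts the centers appointed by the algorithm, with multiplicity and without the initial center $(\bar x,\bar y)$.) **Risk.** Let $D$ be a probability measure on $\mathcal X\times\{-1,1\}$. The risk of $h:\mathcal X\to\{-1,0,1\}$ is the probability of issuing a wrong label, $\mathsf R(h)=D\{(x,y):|y-h(x)|=2\}$. **Bounds.** Let $N\ge0$ be an integer and let $\delta\in(0,1)$. For $k=0,\dots,N-1$ let $\epsilon_k$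 be the only solution $\alpha\in(0,1)$ of $$\frac{\delta}{N}\sum_{m=k}^{N-1}\frac{\binom mk}{\binom Nk}(1-\alpha)^{-(N-m)}=1,$$ and let $\epsilon_k=1$ for $k\ge N$. **Theorem.** Let $(\boldsymbol x_1,\boldsymbol y_1),\dots,(\boldsymbol x_N,\boldsymbol y_N)$ be independent random examples with common law $D$, let $\boldsymbol S$ be the multiset that they form, and let $\boldsymbol k=|\mathsf c(\boldsymbol S)|$. Then $$\Pr\{\mathsf R(\mathcal A(\boldsymbol S))>\epsilon_{\boldsymbol k}\}\le\delta .$$ Moreover $\boldsymbol k\le d$ and $\epsilon_{\boldsymbol k}\le\epsilon_d$ always hold, and therefore $$\Pr\{\mathsf R(\mathcal A(\boldsymbol S))>\epsilon_d\}\le\delta .$$ -/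

import Mathlib

open MeasureTheory ProbabilityTheory Set
open scoped ENNReal

namespace GEM

noncomputable section

/-! ### The functions `Ψ_{k,δ}` and the bounds `ε_k` -/

/-- `Ψ_{k,δ}(α) = (δ/N) ∑_{m=k}^{N-1} (m choose k)/(N choose k) (1-α)^{-(N-m)}`. -/
def Psi (N : ℕ) (δ : ℝ) (k : ℕ) (α : ℝ) : ℝ :=
  δ / N * ∑ m ∈ Finset.Ico k N,
    (m.choose k : ℝ) / (N.choose k : ℝ) * ((1 - α) ^ (N - m))⁻¹

/-- `ε_k`: for `k < N` it is the only solution in `(0,1)` of `Ψ_{k,δ}(α) = 1` (the set below is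
a singleton by `existsUnique_Psi_eq_one`, see `eps_spec`), and it is `1` for `k = N`.
The value for `k > N` is set to `1` as well. -/
def eps (N : ℕ) (δ : ℝ) (k : ℕ) : ℝ :=
  if k < N then sSup {α : ℝ | α ∈ Ioo (0 : ℝ) 1 ∧ Psi N δ k α = 1} else 1

theorem Psi_strictMonoOn {N k : ℕ} {δ : ℝ} (hk : k < N) (h0 : 0 < δ) :
    StrictMonoOn (Psi N δ k) (Iio 1) := by
  intro a ha b hb hab
  have ha' : a < 1 := ha
  have hb' : b < 1 := hb
  have hN : (0 : ℝ) < N := by exact_mod_cast (Nat.zero_le k).trans_lt hk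
  unfold Psi
  refine mul_lt_mul_of_pos_left ?_ (div_pos h0 hN)
  refine Finset.sum_lt_sum_of_nonempty (Finset.nonempty_Ico.2 hk) fun m hm => ?_
  obtain ⟨hkm, hmN⟩ := Finset.mem_Ico.1 hm
  have h1 : (0 : ℝ) < m.choose k := by exact_mod_cast Nat.choose_pos hkm
  have h2 : (0 : ℝ) < N.choose k := by exact_mod_cast Nat.choose_pos hk.le
  refine mul_lt_mul_of_pos_left ?_ (div_pos h1 h2)
  have hb1 : 0 < 1 - b := by linarith
  refine (inv_lt_inv₀ (pow_pos (by linarith) _) (pow_pos hb1 _)).2 ?_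
  exact pow_lt_pow_left₀ (by linarith) hb1.le (by omega)

theorem Psi_continuousOn (N k : ℕ) (δ : ℝ) : ContinuousOn (Psi N δ k) (Iio 1) := by
  unfold Psi
  refine continuousOn_const.mul (continuousOn_finsetSum _ fun m _ => ?_)
  refine continuousOn_const.mul (ContinuousOn.inv₀ (by fun_prop) fun x hx => ?_)
  have hx' : x < 1 := hx
  exact pow_ne_zero _ (by linarith)

theorem existsUnique_Psi_eq_one {N k : ℕ} {δ : ℝ} (hk : k < N) (h0 : 0 < δ) (h1 : δ < 1) :
    ∃! α : ℝ, α ∈ Ioo (0 : ℝ) 1 ∧ Psi N δ k α = 1 := by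
  have hN : (0 : ℝ) < N := by exact_mod_cast (Nat.zero_le k).trans_lt hk
  have hC : (0 : ℝ) < N.choose k := by exact_mod_cast Nat.choose_pos hk.le
  have hlow : Psi N δ k 0 < 1 := by
    have hsum : ∑ m ∈ Finset.Ico k N,
        (m.choose k : ℝ) / (N.choose k : ℝ) * ((1 - (0 : ℝ)) ^ (N - m))⁻¹ ≤ N := by
      calc _ ≤ ∑ m ∈ Finset.Ico k N, (1 : ℝ) := by
            refine Finset.sum_le_sum fun m hm => ?_
            have hm' := (Finset.mem_Ico.1 hm).2.le
            have : (m.choose k : ℝ) ≤ N.choose k := by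
              exact_mod_cast Nat.choose_le_choose k hm'
            simpa using (div_le_one hC).2 this
        _ ≤ N := by simp
    calc Psi N δ k 0 ≤ δ / N * N := mul_le_mul_of_nonneg_left hsum (by positivity)
      _ = δ := by field_simp
      _ < 1 := h1
  obtain ⟨b, hb, hPb⟩ : ∃ b ∈ Ioo (0 : ℝ) 1, 1 < Psi N δ k b := by
    set c : ℝ := δ / N * (((N - 1).choose k : ℝ) / (N.choose k : ℝ)) with hc
    have hc1 : (0 : ℝ) < (N - 1).choose k := by
      exact_mod_cast Nat.choose_pos (by omega : k ≤ N - 1)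
    have hc0 : 0 < c := by positivity
    set t : ℝ := min (1 / 2) (c / 2) with ht
    have ht0 : 0 < t := by positivity
    have ht1 : t ≤ 1 / 2 := min_le_left _ _
    have ht2 : t ≤ c / 2 := min_le_right _ _
    refine ⟨1 - t, ⟨by linarith, by linarith⟩, ?_⟩
    have hterm : ((N - 1).choose k : ℝ) / (N.choose k : ℝ) * t⁻¹ ≤
        ∑ m ∈ Finset.Ico k N,
          (m.choose k : ℝ) / (N.choose k : ℝ) * ((1 - (1 - t)) ^ (N - m))⁻¹ := by
      have := Finset.single_le_sum
        (f := fun m : ℕ => (m.choose k : ℝ) / (N.choose k : ℝ) * ((1 - (1 - t)) ^ (N - m))⁻¹)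
        (s := Finset.Ico k N) (fun m _ => by
          have : 0 ≤ 1 - (1 - t) := by linarith
          positivity)
        (Finset.mem_Ico.2 ⟨by omega, by omega⟩ : N - 1 ∈ Finset.Ico k N)
      have hNN : N - (N - 1) = 1 := by omega
      simpa [hNN] using this
    have h2 : c * t⁻¹ ≤ Psi N δ k (1 - t) := by
      have := mul_le_mul_of_nonneg_left hterm (by positivity : 0 ≤ δ / (N : ℝ))
      unfold Psi
      calc c * t⁻¹ = δ / N * (((N - 1).choose k : ℝ) / (N.choose k : ℝ) * t⁻¹) := by
            rw [hc]; ring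
        _ ≤ _ := this
    have h3 : 1 < c * t⁻¹ := by
      rw [← div_eq_mul_inv, lt_div_iff₀ ht0]; linarith
    linarith
  have hsub : Icc (0 : ℝ) b ⊆ Iio 1 := fun x hx => lt_of_le_of_lt hx.2 hb.2
  obtain ⟨a, ha, hPa⟩ := intermediate_value_Ioo hb.1.le ((Psi_continuousOn N k δ).mono hsub)
    (⟨hlow, hPb⟩ : (1 : ℝ) ∈ Ioo (Psi N δ k 0) (Psi N δ k b))
  refine ⟨a, ⟨⟨ha.1, ha.2.trans hb.2⟩, hPa⟩, ?_⟩
  rintro y ⟨hy, hPy⟩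
  exact (Psi_strictMonoOn hk h0).injOn hy.2 (ha.2.trans hb.2) (hPy.trans hPa.symm)

theorem eps_spec {N k : ℕ} {δ : ℝ} (hk : k < N) (h0 : 0 < δ) (h1 : δ < 1) :
    eps N δ k ∈ Ioo (0 : ℝ) 1 ∧ Psi N δ k (eps N δ k) = 1 := by
  obtain ⟨a, ha, huniq⟩ := existsUnique_Psi_eq_one hk h0 h1
  have hset : {α : ℝ | α ∈ Ioo (0 : ℝ) 1 ∧ Psi N δ k α = 1} = {a} := by
    ext y
    exact ⟨fun hy => huniq y hy, fun hy => by rw [mem_singleton_iff.1 hy]; exact ha⟩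
  have : eps N δ k = a := by rw [eps, if_pos hk, hset, csSup_singleton]
  rw [this]; exact ha

/-! ### The Guaranteed Error Machine

Labels are elements of `ℤˣ = {1, -1}`, an example is a pair `(x, y) : X × ℤˣ`, and ternary
classifiers are maps `X → SignType`, where `SignType = {-1, 0, 1}`. -/

/-- The loss: `1` if `|y - h(x)| = 2` (a wrong label is issued), and `0` otherwise. -/
def loss {X : Type*} (h : X → SignType) (z : X × ℤˣ) : ℕ :=
  if |(z.2 : ℤ) - (h z.1 : ℤ)| = 2 then 1 else 0

/-- The risk `R(h)`: the probability that `ℓ(h, z) = 1` when `z` has law `D`. -/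
def risk {X : Type*} [MeasurableSpace X] (D : Measure (X × ℤˣ)) (h : X → SignType) : ℝ :=
  D.real {z | loss h z = 1}

/-- The variables of the algorithm: the multiset `P` of examples still in play, the compression
multiset `C`, the current center `(x_C, y_C)`, and the list `(R_1, ℓ_1), …, (R_q, ℓ_q)` of the
labelled regions formed so far. -/
structure State (X : Type*) where
  P : Multiset (X × ℤˣ)
  C : Multiset (X × ℤˣ)
  center : X × ℤˣ
  regions : List (Set X × ℤˣ)

variable {X H : Type*} [NormedAddCommGroup H]

/-- The largest `r ∈ [0, ∞]` with `‖φ(x_i) - φ(x_C)‖ ≥ r` for all `(x_i, y_i) ∈ P` with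
`y_i ≠ y_C`. -/
def radius (φ : X → H) (P : Multiset (X × ℤˣ)) (c : X × ℤˣ) : ℝ≥0∞ :=
  sSup {r : ℝ≥0∞ | ∀ z ∈ P, z.2 ≠ c.2 → r ≤ ‖φ z.1 - φ c.1‖ₑ}

/-- The region `{x : ‖φ(x) - φ(x_C)‖ < r}`. -/
def region (φ : X → H) (c : X × ℤˣ) (r : ℝ≥0∞) : Set X :=
  {x | ‖φ x - φ c.1‖ₑ < r}

variable [LinearOrder X]

/-- `z ∈ P` lies at distance `r` from the center `c` in feature space, has the label different from
that of `c`, and its instance is the smallest among all the examples with these properties. Since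
there are two labels, there is at most one such `z`. -/
def IsNextCenter (φ : X → H) (P : Multiset (X × ℤˣ)) (c : X × ℤˣ) (r : ℝ≥0∞) (z : X × ℤˣ) : Prop :=
  (z ∈ P ∧ ‖φ z.1 - φ c.1‖ₑ = r ∧ z.2 ≠ c.2) ∧
    ∀ w ∈ P, ‖φ w.1 - φ c.1‖ₑ = r → w.2 ≠ c.2 → z.1 ≤ w.1

open Classical in
/-- The update of `P`: if `r > 0`, all the examples with instance in the region are removed; if
`r = 0`, one copy of the center is removed. -/
def update (φ : X → H) (P : Multiset (X × ℤˣ)) (c : X × ℤˣ) (r : ℝ≥0∞) : Multiset (X × ℤˣ) :=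
  if 0 < r then P.filter (fun z => z.1 ∉ region φ c r) else P.erase c

open Classical in
/-- The next center. The default value `c` is never used by the algorithm: it asks for a next
center only if `r < ∞`, in which case there is one (`exists_isNextCenter`). -/
def nextCenter (φ : X → H) (P : Multiset (X × ℤˣ)) (c : X × ℤˣ) (r : ℝ≥0∞) : X × ℤˣ :=
  if h : ∃ z, IsNextCenter φ P c r z then h.choose else c

/-- One pass: the radius, the new region, the update of `P` and, if the radius is finite, the new
center, which is added to `C`. -/
def step (φ : X → H) (s : State X) : State X :=
  let r := radius φ s.P s.center
  let P' := update φ s.P s.center r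
  let regions' := s.regions ++ [(region φ s.center r, s.center.2)]
  if r < ∞ then
    let z := nextCenter φ P' s.center r
    ⟨P', z ::ₘ s.C, z, regions'⟩
  else ⟨P', s.C, s.center, regions'⟩

/-- Repeat `step` until `|C| = d` or `P = ∅`, for at most `n` passes. -/
def loop (φ : X → H) (d : ℕ) : ℕ → State X → State X
  | 0, s => s
  | n + 1, s =>
    let s' := step φ s
    if s'.C.card = d ∨ s'.P = 0 then s' else loop φ d n s'

/-- The final state of the algorithm, with initial center `zbar`, run on the training set `S`.
A pass that does not end the algorithm adds an element to `C`, hence there are never more than `d`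
passes (see `run_stopped`). -/
def run (φ : X → H) (zbar : X × ℤˣ) (d : ℕ) (S : Multiset (X × ℤˣ)) : State X :=
  loop φ d d ⟨zbar ::ₘ S, 0, zbar, []⟩

/-- The compression `c(S) = C`. -/
def compression (φ : X → H) (zbar : X × ℤˣ) (d : ℕ) (S : Multiset (X × ℤˣ)) :
    Multiset (X × ℤˣ) :=
  (run φ zbar d S).C

open Classical in
/-- The predictor: the label of the first region that contains `x`, and `0` if there is none. -/
def predictor (φ : X → H) (zbar : X × ℤˣ) (d : ℕ) (S : Multiset (X × ℤˣ)) (x : X) : SignType :=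
  match (run φ zbar d S).regions.find? (fun R => decide (x ∈ R.1)) with
  | none => 0
  | some R => SignType.sign (R.2 : ℤ)

theorem exists_isNextCenter (φ : X → H) (P : Multiset (X × ℤˣ)) (c : X × ℤˣ)
    (hr : radius φ P c < ∞) :
    ∃ z, IsNextCenter φ (update φ P c (radius φ P c)) c (radius φ P c) z := by
  classical
  set r := radius φ P c with hrdef
  have hle : ∀ z ∈ P, z.2 ≠ c.2 → r ≤ ‖φ z.1 - φ c.1‖ₑ := fun z hz hzc =>
    sSup_le fun t ht => ht z hz hzc
  have hex : ∃ z ∈ P, z.2 ≠ c.2 ∧ ‖φ z.1 - φ c.1‖ₑ = r := by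
    have hne : (P.toFinset.filter fun z => z.2 ≠ c.2).Nonempty := by
      by_contra hne
      rw [Finset.not_nonempty_iff_eq_empty, Finset.filter_eq_empty_iff] at hne
      refine hr.ne (top_le_iff.1 (le_sSup fun z hz hzc => ?_))
      exact absurd hzc (hne (Multiset.mem_toFinset.2 hz))
    obtain ⟨z, hz, hmin⟩ := Finset.exists_min_image _ (fun z => ‖φ z.1 - φ c.1‖ₑ) hne
    rw [Finset.mem_filter, Multiset.mem_toFinset] at hz
    refine ⟨z, hz.1, hz.2, le_antisymm (le_sSup fun w hw hwc => ?_) (hle z hz.1 hz.2)⟩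
    exact hmin w (Finset.mem_filter.2 ⟨Multiset.mem_toFinset.2 hw, hwc⟩)
  have hmem : ∀ z ∈ P, z.2 ≠ c.2 → ‖φ z.1 - φ c.1‖ₑ = r → z ∈ update φ P c r := by
    intro z hz hzc hzr
    unfold update
    split_ifs
    · exact Multiset.mem_filter.2 ⟨hz, by simp [region, hzr]⟩
    · exact (Multiset.mem_erase_of_ne fun h => hzc (by rw [h])).2 hz
  obtain ⟨z₀, h₀, h₀c, h₀r⟩ := hex
  obtain ⟨z, hz, hmin⟩ := Finset.exists_min_image
    ((update φ P c r).toFinset.filter fun z => ‖φ z.1 - φ c.1‖ₑ = r ∧ z.2 ≠ c.2)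
    (fun z => z.1) ⟨z₀, by simpa using ⟨hmem z₀ h₀ h₀c h₀r, h₀r, h₀c⟩⟩
  rw [Finset.mem_filter, Multiset.mem_toFinset] at hz
  exact ⟨z, hz, fun w hw hwr hwc =>
    hmin w (Finset.mem_filter.2 ⟨Multiset.mem_toFinset.2 hw, hwr, hwc⟩)⟩

theorem step_card (φ : X → H) (s : State X) :
    (step φ s).P = 0 ∨ (step φ s).C.card = s.C.card + 1 := by
  by_cases hr : radius φ s.P s.center < ∞
  · right; simp [step, hr]
  · left
    have hr' : radius φ s.P s.center = ∞ := not_lt_top_iff.1 hr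
    simp [step, update, region, hr']

theorem loop_stopped (φ : X → H) (d : ℕ) : ∀ (n : ℕ) (s : State X), 1 ≤ n → s.C.card + n = d →
    (loop φ d n s).C.card = d ∨ (loop φ d n s).P = 0
  | n + 1, s, _, hs => by
    unfold loop
    by_cases h : (step φ s).C.card = d ∨ (step φ s).P = 0
    · simp only [h, if_true]
    · simp only [h, if_false]
      rw [not_or] at h
      have hc := (step_card φ s).resolve_left h.2
      have := h.1
      exact loop_stopped φ d n _ (by omega) (by omega)

/-- The bound on the number of passes in `run` is not active: the algorithm ends by its own
stopping rule. -/
theorem run_stopped (φ : X → H) (zbar : X × ℤˣ) {d : ℕ} (hd : 1 ≤ d) (S : Multiset (X × ℤˣ)) :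
    (run φ zbar d S).C.card = d ∨ (run φ zbar d S).P = 0 :=
  loop_stopped φ d d _ hd (by simp)

end

end GEM

namespace GEM

/-! ### Deterministic properties of the algorithm: stability of the compression, labels of the other
examples -/

section Deterministic

variable {X H : Type*} [NormedAddCommGroup H]

/-! The algorithm is a compression scheme with two deterministic properties. Discarding training
examples outside the compression changes nothing (`predictor_eq_of_le`, from `loop_eq_of_le`), and a
surplus copy of an example is never misclassified (`loss_predictor_ne_one`, from
`label_of_find?_loop`).

For a set `J` of `m` indices, train on `J` and test on the other `N - m` examples. The indicator of
no error, divided by the conditional probability `(1 - R_J)^(N - m)` of no error, has mean at most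
`1` (`lintegral_holdOut_le`). With weights `δ / N / N.choose m`, summed over all `J` with `m < N`,
these variables form `errorStatistic`, whose mean is at most `δ`.

Let `I` be a set of `k` indices that carries the compression. For every `J ⊇ I` the predictor
trained on `J` is the full one, with risk `R`, and it makes no error outside `J`, so that the term
of `J` equals `(1 - R)^(-(N - m))`. There are `(N - k).choose (m - k)` such `J` of size `m`. Hence,
if `R > ε_k`, the statistic is at least `Psi N δ k ε_k = 1` (`one_le_errorStatistic`), and Markov's
inequality concludes. The bound with `ε_d` follows from `k ≤ d` and `eps_mono`.

Integration requires measurability of the error event: it depends only on finitely many measurable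
comparisons among the examples (`measurableSet_loss_predictor`). -/

theorem units_eq_of_ne_of_ne {a b c : ℤˣ} (ha : a ≠ c) (hb : b ≠ c) : a = b := by
  revert a b c; decide

theorem le_radius_iff {φ : X → H} {P : Multiset (X × ℤˣ)} {c : X × ℤˣ} {r : ℝ≥0∞} :
    r ≤ radius φ P c ↔ ∀ z ∈ P, z.2 ≠ c.2 → r ≤ ‖φ z.1 - φ c.1‖ₑ :=
  ⟨fun h _ hz hzc => h.trans (sSup_le fun _ ht => ht _ hz hzc), fun h => le_sSup h⟩

theorem radius_anti {φ : X → H} {P Q : Multiset (X × ℤˣ)} (h : P ≤ Q) (c : X × ℤˣ) :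
    radius φ Q c ≤ radius φ P c :=
  le_radius_iff.2 fun z hz hzc => le_radius_iff.1 le_rfl z (Multiset.mem_of_le h hz) hzc

theorem mem_region_self {φ : X → H} {c : X × ℤˣ} {r : ℝ≥0∞} (hr : 0 < r) : c.1 ∈ region φ c r := by
  simpa [region] using hr

variable [LinearOrder X]

theorem IsNextCenter.unique {φ : X → H} {P : Multiset (X × ℤˣ)} {c : X × ℤˣ} {r : ℝ≥0∞}
    {z w : X × ℤˣ} (hz : IsNextCenter φ P c r z) (hw : IsNextCenter φ P c r w) : z = w :=
  Prod.ext (le_antisymm (hz.2 w hw.1.1 hw.1.2.1 hw.1.2.2) (hw.2 z hz.1.1 hz.1.2.1 hz.1.2.2))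
    (units_eq_of_ne_of_ne hz.1.2.2 hw.1.2.2)

theorem nextCenter_eq {φ : X → H} {P : Multiset (X × ℤˣ)} {c : X × ℤˣ} {r : ℝ≥0∞}
    {z : X × ℤˣ} (hz : IsNextCenter φ P c r z) : nextCenter φ P c r = z := by
  have h : ∃ z, IsNextCenter φ P c r z := ⟨z, hz⟩
  rw [nextCenter, dif_pos h]
  exact h.choose_spec.unique hz

theorem update_le (φ : X → H) (P : Multiset (X × ℤˣ)) (c : X × ℤˣ) (r : ℝ≥0∞) :
    update φ P c r ≤ P := by
  classical
  unfold update
  split_ifs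
  exacts [Multiset.filter_le _ _, Multiset.erase_le _ _]

theorem update_mono (φ : X → H) {P Q : Multiset (X × ℤˣ)} (h : P ≤ Q) (c : X × ℤˣ) (r : ℝ≥0∞) :
    update φ P c r ≤ update φ Q c r := by
  classical
  unfold update
  split_ifs
  exacts [Multiset.filter_le_filter _ h, Multiset.erase_le_erase _ h]

/-- Every pass uses up a copy of the center: for positive radius the center lies in its own region,
so all its copies go; for radius zero one copy is erased. -/
theorem cons_update_le {φ : X → H} {P : Multiset (X × ℤˣ)} {c : X × ℤˣ} (hc : c ∈ P) (r : ℝ≥0∞) :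
    c ::ₘ update φ P c r ≤ P := by
  classical
  have hcons : c ::ₘ P.erase c = P := Multiset.cons_erase hc
  by_cases hr : 0 < r
  · have : update φ P c r ≤ P.erase c := by
      rw [← Multiset.erase_of_notMem (a := c) (s := update φ P c r)]
      · exact Multiset.erase_le_erase _ (update_le φ P c r)
      · simp [update, hr, mem_region_self hr]
    exact ((Multiset.cons_le_cons_iff c).2 this).trans hcons.le
  · rw [update, if_neg hr]
    convert hcons.le

theorem count_update [DecidableEq X] {φ : X → H} {P : Multiset (X × ℤˣ)} {c w : X × ℤˣ}
    {r : ℝ≥0∞} (hw : w.1 ∉ region φ c r) :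
    P.count w ≤ (update φ P c r).count w + ({c} : Multiset (X × ℤˣ)).count w := by
  classical
  unfold update
  split_ifs with hr
  · rw [Multiset.count_filter_of_pos (p := fun z : X × ℤˣ => z.1 ∉ region φ c r) hw]
    exact Nat.le_add_right _ _
  · rw [← Multiset.count_add, add_comm, Multiset.singleton_add]
    refine Multiset.count_le_of_le _ ?_
    convert Multiset.le_cons_erase P c

theorem step_of_lt {φ : X → H} {s : State X} (hr : radius φ s.P s.center < ∞) :
    ∃ z, IsNextCenter φ (update φ s.P s.center (radius φ s.P s.center)) s.center
        (radius φ s.P s.center) z ∧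
      step φ s = ⟨update φ s.P s.center (radius φ s.P s.center), z ::ₘ s.C, z,
        s.regions ++ [(region φ s.center (radius φ s.P s.center), s.center.2)]⟩ := by
  obtain ⟨z, hz⟩ := exists_isNextCenter φ s.P s.center hr
  refine ⟨z, hz, ?_⟩
  simp only [step, if_pos hr, nextCenter_eq hz]

theorem step_of_eq_top {φ : X → H} {s : State X} (hr : radius φ s.P s.center = ∞) :
    step φ s = ⟨0, s.C, s.center, s.regions ++ [(univ, s.center.2)]⟩ := by
  simp [step, hr, update, region]

theorem loop_succ_of_eq_top {φ : X → H} {s : State X} (hr : radius φ s.P s.center = ∞)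
    (d n : ℕ) :
    loop φ d (n + 1) s = ⟨0, s.C, s.center, s.regions ++ [(univ, s.center.2)]⟩ := by
  simp [loop, step_of_eq_top hr]

/-- The invariant `s.center ∈ s.P` holds because a newly appointed center is still in `P`. Hence
after a pass of finite radius `P` is nonempty, and only `|C| = d` can stop the loop. -/
theorem loop_induction {φ : X → H} {d : ℕ} {motive : ℕ → State X → Prop}
    (zero : ∀ s : State X, s.center ∈ s.P → motive 0 s)
    (top : ∀ n (s : State X), s.center ∈ s.P → radius φ s.P s.center = ∞ → motive (n + 1) s)
    (succ : ∀ n (s t : State X) z, s.center ∈ s.P → radius φ s.P s.center < ∞ →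
      IsNextCenter φ (update φ s.P s.center (radius φ s.P s.center)) s.center
        (radius φ s.P s.center) z →
      t = ⟨update φ s.P s.center (radius φ s.P s.center), z ::ₘ s.C, z,
        s.regions ++ [(region φ s.center (radius φ s.P s.center), s.center.2)]⟩ →
      (loop φ d (n + 1) s = t ∧ t.C.card = d ∧ motive 0 t ∨
        loop φ d (n + 1) s = loop φ d n t ∧ t.C.card ≠ d ∧ motive n t) → motive (n + 1) s)
    (n : ℕ) (s : State X) (hs : s.center ∈ s.P) : motive n s := by
  induction n generalizing s with
  | zero => exact zero s hs
  | succ n ih =>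
    rcases lt_or_ge (radius φ s.P s.center) ∞ with hr | hr
    · obtain ⟨z, hz, ht⟩ := step_of_lt hr
      refine succ n s _ z hs hr hz ht ?_
      have hmem : (step φ s).center ∈ (step φ s).P := by rw [ht]; exact hz.1.1
      have hP : (step φ s).P ≠ 0 := fun h => by simp [h] at hmem
      by_cases hd : (step φ s).C.card = d
      · exact Or.inl ⟨by simp [loop, hd], hd, zero _ hmem⟩
      · exact Or.inr ⟨by simp [loop, hd, hP], hd, ih _ hmem⟩
    · exact top n s hs (top_le_iff.1 hr)

theorem loop_regions (φ : X → H) (d n : ℕ) (s : State X) :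
    ∃ L, (loop φ d n s).regions = s.regions ++ L := by
  induction n generalizing s with
  | zero => exact ⟨[], by simp [loop]⟩
  | succ n ih =>
    obtain ⟨L, hL⟩ := ih (step φ s)
    have hstep : (step φ s).regions = s.regions ++
        [(region φ s.center (radius φ s.P s.center), s.center.2)] := by
      simp only [step]; split_ifs <;> rfl
    simp only [loop]
    split_ifs
    · exact ⟨_, hstep⟩
    · exact ⟨_, by rw [hL, hstep, List.append_assoc]⟩

theorem le_loop_C (φ : X → H) (d n : ℕ) (s : State X) : s.C ≤ (loop φ d n s).C := by
  induction n generalizing s with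
  | zero => simp [loop]
  | succ n ih =>
    have hstep : s.C ≤ (step φ s).C := by
      simp only [step]; split_ifs
      exacts [Multiset.le_cons_self _ _, le_rfl]
    simp only [loop]
    split_ifs
    exacts [hstep, hstep.trans (ih _)]

theorem card_loop_C_le (φ : X → H) (d n : ℕ) (s : State X) :
    (loop φ d n s).C.card ≤ s.C.card + n := by
  induction n generalizing s with
  | zero => simp [loop]
  | succ n ih =>
    have hstep : (step φ s).C.card ≤ s.C.card + 1 := by
      simp only [step]; split_ifs <;> simp
    have := ih (step φ s)
    simp only [loop]
    split_ifs <;> omega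

/-- Accounting of copies: the current center still occupies a copy in `P`, which the pass consumes,
while the next center enters `C` before its copy leaves `P`. The term `{s.center}` pays for this
delay, and for the initial center, which never enters `C`. -/
theorem loop_C_add_center_le (φ : X → H) (d n : ℕ) (s : State X) (hs : s.center ∈ s.P) :
    (loop φ d n s).C + {s.center} ≤ s.C + s.P := by
  refine loop_induction (φ := φ) (d := d)
    (motive := fun n s => (loop φ d n s).C + {s.center} ≤ s.C + s.P) ?_ ?_ ?_ n s hs
  · intro s hs
    simpa [loop] using hs
  · intro n s hs hr
    rw [loop_succ_of_eq_top hr]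
    simpa using hs
  · rintro n s t z hs hr hz rfl h
    set u := update φ s.P s.center (radius φ s.P s.center) with hu
    have hsP : s.center ::ₘ u ≤ s.P := cons_update_le hs _
    have key : ∀ L : Multiset (X × ℤˣ), L + {z} ≤ (z ::ₘ s.C) + u →
        L + {s.center} ≤ s.C + s.P := by
      intro L hL
      have h1 : L ≤ s.C + u := by
        rw [Multiset.cons_add, ← Multiset.singleton_add, add_comm L] at hL
        exact le_of_add_le_add_left hL
      calc L + {s.center} ≤ s.C + u + {s.center} := by gcongr
        _ = s.C + (s.center ::ₘ u) := by rw [← Multiset.singleton_add]; abel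
        _ ≤ _ := by gcongr
    rcases h with ⟨h, -, ih⟩ | ⟨h, -, ih⟩
    · rw [h]; exact key _ ih
    · rw [h]; exact key _ ih

/-- The loop run on a smaller multiset of examples that still contains all the centers appointed by
the original loop appoints the same centers and forms the same regions. -/
theorem loop_eq_of_le (φ : X → H) (d n : ℕ) (s : State X) (hs : s.center ∈ s.P) :
    ∀ Q ≤ s.P, (loop φ d n s).C + {s.center} ≤ s.C + Q →
      (loop φ d n ⟨Q, s.C, s.center, s.regions⟩).C = (loop φ d n s).C ∧
      (loop φ d n ⟨Q, s.C, s.center, s.regions⟩).regions = (loop φ d n s).regions := by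
  refine loop_induction (φ := φ) (d := d)
    (motive := fun n s => ∀ Q ≤ s.P, (loop φ d n s).C + {s.center} ≤ s.C + Q →
      (loop φ d n ⟨Q, s.C, s.center, s.regions⟩).C = (loop φ d n s).C ∧
      (loop φ d n ⟨Q, s.C, s.center, s.regions⟩).regions = (loop φ d n s).regions)
    ?_ ?_ ?_ n s hs
  · intro s _ Q _ _
    simp [loop]
  · intro n s _ hr Q hQ _
    have hr' : radius φ Q s.center = ∞ := top_le_iff.1 (hr ▸ radius_anti hQ _)
    rw [loop_succ_of_eq_top hr, loop_succ_of_eq_top (s := ⟨Q, s.C, s.center, s.regions⟩) hr']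
    exact ⟨rfl, rfl⟩
  · intro n s t z hs hr hz ht h Q hQ hle
    classical
    set r := radius φ s.P s.center with hrdef
    have htC : t.C = z ::ₘ s.C := by rw [ht]
    have htc : t.center = z := by rw [ht]
    have htP : t.P = update φ s.P s.center r := by rw [ht]
    have hmemt : t.center ∈ t.P := by rw [htc, htP]; exact hz.1.1
    have hLt : t.C ≤ (loop φ d (n + 1) s).C ∧
        (loop φ d (n + 1) s).C + {z} ≤ (z ::ₘ s.C) + update φ s.P s.center r := by
      rcases h with ⟨h, -, -⟩ | ⟨h, -, -⟩
      · rw [h]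
        refine ⟨le_rfl, ?_⟩
        have := loop_C_add_center_le φ d 0 t hmemt
        simpa only [loop, htC, htc, htP] using this
      · rw [h]
        refine ⟨le_loop_C _ _ _ _, ?_⟩
        have := loop_C_add_center_le φ d n t hmemt
        simpa only [htC, htc, htP] using this
    obtain ⟨hCL, hLu⟩ := hLt
    set L := (loop φ d (n + 1) s).C with hL
    have hzne : z ≠ s.center := fun h => hz.1.2.2 (by rw [h])
    -- `L` contains one more copy of `z` than `s.C`, and by `hle` only `Q` can provide it.
    have hzQ : z ∈ Q := by
      have h1 := Multiset.count_le_of_le z hle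
      have h2 := Multiset.count_le_of_le z hCL
      rw [htC] at h2
      simp only [Multiset.count_add, Multiset.count_cons_self] at h1 h2
      exact Multiset.count_pos.1 (by omega)
    -- Fewer examples can only enlarge the radius, but `z`, which realizes it, is still in `Q`.
    have hrQ : radius φ Q s.center = r := by
      refine le_antisymm ?_ (radius_anti hQ _)
      exact (le_radius_iff.1 le_rfl z hzQ hz.1.2.2).trans hz.1.2.1.le
    have hzreg : z.1 ∉ region φ s.center r := by simp [region, hz.1.2.1]
    have hzuQ : z ∈ update φ Q s.center r := by
      have h1 := count_update (P := Q) hzreg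
      rw [Multiset.count_singleton, if_neg hzne] at h1
      exact Multiset.count_pos.1 ((Multiset.count_pos.2 hzQ).trans_le h1)
    have hzQnext : IsNextCenter φ (update φ Q s.center r) s.center r z :=
      ⟨⟨hzuQ, hz.1.2⟩, fun w hw => hz.2 w (Multiset.mem_of_le (update_mono φ hQ _ _) hw)⟩
    have hstepQ : step φ ⟨Q, s.C, s.center, s.regions⟩ =
        ⟨update φ Q s.center r, t.C, t.center, t.regions⟩ := by
      simp only [step, hrQ, if_pos hr, nextCenter_eq hzQnext, ht]
    have hLQ : L + {t.center} ≤ t.C + update φ Q s.center r := by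
      rw [htC, htc, Multiset.cons_add, ← Multiset.singleton_add, add_comm L]
      -- Compare copies of each `w`. Inside the region, `w` is gone from `P` and `L` gets no further
      -- copy of it; outside, `Q` loses at most the copy of the center that `hle` has already set
      -- aside.
      refine add_le_add_right (Multiset.le_iff_count.2 fun w => ?_) _
      have h1 := Multiset.count_le_of_le w hle
      have h2 := Multiset.count_le_of_le w hLu
      rw [Multiset.cons_add, ← Multiset.singleton_add] at h2
      simp only [Multiset.count_add] at h1 h2 ⊢
      by_cases hw : w.1 ∈ region φ s.center r
      · have hr0 : 0 < r := lt_of_le_of_lt (zero_le) hw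
        have : Multiset.count w (update φ s.P s.center r) = 0 := by
          rw [Multiset.count_eq_zero]
          simp [update, hr0, hw]
        omega
      · have := count_update (P := Q) hw
        omega
    have hQne : update φ Q s.center r ≠ 0 := fun h => by simp [h] at hzuQ
    have hle' : update φ Q s.center r ≤ t.P := htP ▸ update_mono φ hQ _ _
    rcases h with ⟨h, hd, ih⟩ | ⟨h, hd, ih⟩
    · rw [hL, h]
      simp only [loop, hstepQ, hd, true_or, if_true, and_self]
    · have : loop φ d (n + 1) ⟨Q, s.C, s.center, s.regions⟩ =
          loop φ d n ⟨update φ Q s.center r, t.C, t.center, t.regions⟩ := by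
        simp only [loop, hstepQ, hd, hQne, or_self, if_false]
      rw [this, hL, h]
      exact ih _ hle' (by rw [← h]; exact hLQ)

open Classical in
/-- An example whose copies are not all used as centers belongs to no region or the first region
that contains it has its label. -/
theorem label_of_find?_loop (φ : X → H) (d n : ℕ) (s : State X) (hs : s.center ∈ s.P)
    (w : X × ℤˣ) :
    (loop φ d n s).C.count w + ({s.center} : Multiset (X × ℤˣ)).count w < (s.C + s.P).count w →
    (∀ R ∈ s.regions, w.1 ∉ R.1) →
    ∀ R, (loop φ d n s).regions.find? (fun R => decide (w.1 ∈ R.1)) = some R → R.2 = w.2 := by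
  have hfind : ∀ {l L : List (Set X × ℤˣ)} {A R : Set X × ℤˣ}, (∀ R ∈ l, w.1 ∉ R.1) →
      w.1 ∈ A.1 → ((l ++ [A]) ++ L).find? (fun R => decide (w.1 ∈ R.1)) = some R → R = A := by
    intro l L A R hl hA h
    have hnone : l.find? (fun R => decide (w.1 ∈ R.1)) = none := by
      simpa [List.find?_eq_none] using hl
    simp [List.find?_append, hnone, hA] at h
    exact h.symm
  refine loop_induction (φ := φ) (d := d)
    (motive := fun n s =>
      (loop φ d n s).C.count w + ({s.center} : Multiset (X × ℤˣ)).count w < (s.C + s.P).count w →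
      (∀ R ∈ s.regions, w.1 ∉ R.1) →
      ∀ R, (loop φ d n s).regions.find? (fun R => decide (w.1 ∈ R.1)) = some R → R.2 = w.2)
    ?_ ?_ ?_ n s hs
  · intro s _ _ hreg R hR
    exact absurd (by simpa using List.find?_some hR) (hreg R (List.mem_of_find?_eq_some hR))
  · intro n s _ hr hcount hreg R hR
    rw [loop_succ_of_eq_top hr] at hcount hR
    have hw : w ∈ s.P := by
      rw [Multiset.count_add] at hcount
      exact Multiset.count_pos.1 (by simp only at hcount; omega)
    have hRA := hfind (L := []) hreg (mem_univ w.1) (by rw [List.append_nil]; exact hR)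
    rw [hRA]
    by_contra hne
    have := le_radius_iff.1 hr.ge w hw (Ne.symm hne)
    simp at this
  · intro n s t z hs hr hz ht h hcount hreg R hR
    set r := radius φ s.P s.center with hrdef
    have htreg : t.regions = s.regions ++ [(region φ s.center r, s.center.2)] := by rw [ht]
    -- If `w` is in the new region, this is the first region to contain it, and a label different
    -- from that of the center would contradict the definition of the radius. Otherwise the surplus
    -- copy of `w` survives the pass.
    by_cases hwr : w.1 ∈ region φ s.center r
    · have hw : w ∈ s.P := by
        rw [Multiset.count_add] at hcount
        have := Multiset.count_le_of_le w (le_loop_C φ d (n + 1) s)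
        exact Multiset.count_pos.1 (by omega)
      obtain ⟨L, hL⟩ : ∃ L, (loop φ d (n + 1) s).regions = t.regions ++ L := by
        rcases h with ⟨h, -, -⟩ | ⟨h, -, -⟩
        · exact ⟨[], by rw [h, List.append_nil]⟩
        · rw [h]; exact loop_regions _ _ _ _
      rw [hL, htreg] at hR
      rw [hfind hreg hwr hR]
      by_contra hne
      exact (le_radius_iff.1 le_rfl w hw (Ne.symm hne)).not_gt hwr
    · have hregt : ∀ R ∈ t.regions, w.1 ∉ R.1 := by
        intro A hA
        rw [htreg, List.mem_append, List.mem_singleton] at hA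
        rcases hA with hA | rfl
        exacts [hreg A hA, hwr]
      have hcountt : (loop φ d (n + 1) s).C.count w + ({t.center} : Multiset (X × ℤˣ)).count w <
          (t.C + t.P).count w := by
        rw [ht, Multiset.cons_add, ← Multiset.singleton_add z (s.C + _)]
        have := count_update (P := s.P) hwr
        simp only [Multiset.count_add] at hcount ⊢
        omega
      rcases h with ⟨h, -, ih⟩ | ⟨h, -, ih⟩
      · rw [h] at hcountt hR
        exact ih hcountt hregt R hR
      · rw [h] at hcountt hR
        exact ih hcountt hregt R hR

theorem compression_le (φ : X → H) (zbar : X × ℤˣ) (d : ℕ) (S : Multiset (X × ℤˣ)) :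
    compression φ zbar d S ≤ S := by
  have := loop_C_add_center_le φ d d ⟨zbar ::ₘ S, 0, zbar, []⟩ (Multiset.mem_cons_self _ _)
  rw [zero_add, ← Multiset.singleton_add, add_comm] at this
  exact le_of_add_le_add_left this

theorem card_compression_le (φ : X → H) (zbar : X × ℤˣ) (d : ℕ) (S : Multiset (X × ℤˣ)) :
    (compression φ zbar d S).card ≤ d := by
  simpa [compression, run] using card_loop_C_le φ d d ⟨zbar ::ₘ S, 0, zbar, []⟩

/-- Examples that are not in the compression have no influence on the predictor. -/
theorem predictor_eq_of_le {φ : X → H} {zbar : X × ℤˣ} {d : ℕ} {S T : Multiset (X × ℤˣ)}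
    (hTS : T ≤ S) (hT : compression φ zbar d S ≤ T) :
    predictor φ zbar d T = predictor φ zbar d S := by
  have := (loop_eq_of_le φ d d ⟨zbar ::ₘ S, 0, zbar, []⟩ (Multiset.mem_cons_self _ _)
    (zbar ::ₘ T) ((Multiset.cons_le_cons_iff _).2 hTS) (by
      rw [zero_add, ← Multiset.singleton_add, add_comm]
      exact add_le_add_right hT _)).2
  funext x
  unfold predictor run
  rw [this]

/-- An example is not misclassified if it has more copies in the training set than in the
compression. -/
theorem loss_predictor_ne_one {φ : X → H} {zbar : X × ℤˣ} {d : ℕ} {S : Multiset (X × ℤˣ)}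
    {w : X × ℤˣ} (hw : w ::ₘ compression φ zbar d S ≤ S) :
    loss (predictor φ zbar d S) w ≠ 1 := by
  classical
  have hcount := Multiset.count_le_of_le w hw
  rw [Multiset.count_cons_self] at hcount
  have key := label_of_find?_loop φ d d ⟨zbar ::ₘ S, 0, zbar, []⟩ (Multiset.mem_cons_self _ _) w
    (by
      rw [zero_add, ← Multiset.singleton_add zbar S, Multiset.count_add, add_comm]
      refine Nat.add_lt_add_left ?_ _
      rw [Multiset.singleton_add]
      exact hcount)
    (by simp)
  have hone : ∀ u : ℤˣ, |(u : ℤ) - ((SignType.sign (u : ℤ) : SignType) : ℤ)| ≠ 2 ∧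
      |(u : ℤ) - ((0 : SignType) : ℤ)| ≠ 2 := by decide
  rw [loss, predictor]
  split
  · simpa using (hone w.2).2
  · next R hR => simpa [key R (by convert hR; rfl)] using (hone w.2).1

end Deterministic

/-! ### Measurability: the error event depends on finitely many comparisons -/

section Measurability

variable {X H ι κ : Type*} [NormedAddCommGroup H]

theorem measurableSingletonClass_intUnits : MeasurableSingletonClass ℤˣ where
  measurableSet_singleton u := by
    have : ({u} : Set ℤˣ) = Units.val ⁻¹' {(u : ℤ)} := by ext v; simp [Units.ext_iff]
    rw [this]
    exact ⟨_, trivial, rfl⟩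

theorem radius_eq {φ : X → H} {P : Multiset (X × ℤˣ)} {c z : X × ℤˣ} (hz : z ∈ P)
    (hzc : z.2 ≠ c.2) (h : ∀ w ∈ P, w.2 ≠ c.2 → ‖φ z.1 - φ c.1‖ₑ ≤ ‖φ w.1 - φ c.1‖ₑ) :
    radius φ P c = ‖φ z.1 - φ c.1‖ₑ :=
  le_antisymm (le_radius_iff.1 le_rfl z hz hzc) (le_radius_iff.2 h)

theorem radius_eq_top_iff {φ : X → H} {P : Multiset (X × ℤˣ)} {c : X × ℤˣ} :
    radius φ P c = ∞ ↔ ∀ z ∈ P, z.2 = c.2 := by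
  rw [← top_le_iff, le_radius_iff]
  refine forall₂_congr fun z _ => ?_
  simp

variable [LinearOrder X]

/-- Two families of examples with the same labels, ordered in the same way, and whose distances in
feature space are ordered in the same way. -/
structure SameType (φ : X → H) (a b : ι → X × ℤˣ) : Prop where
  label : ∀ i, (a i).2 = (b i).2
  le_iff : ∀ i j, (a i).1 ≤ (a j).1 ↔ (b i).1 ≤ (b j).1
  dist_le_iff : ∀ i j k l, ‖φ (a i).1 - φ (a j).1‖ₑ ≤ ‖φ (a k).1 - φ (a l).1‖ₑ ↔
    ‖φ (b i).1 - φ (b j).1‖ₑ ≤ ‖φ (b k).1 - φ (b l).1‖ₑ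

/-- Two regions containing, respectively, `x` and `y` or not, with the same label. -/
def SameRegion (x y : X) (R T : Set X × ℤˣ) : Prop :=
  (x ∈ R.1 ↔ y ∈ T.1) ∧ R.2 = T.2

/-- The states `s` and `t` come from the same indices in the families `a` and `b`. -/
structure SameState (a b : ι → X × ℤˣ) (o : ι) (Q : Multiset ι) (i : ι) (s t : State X) :
    Prop where
  mem : i ∈ Q
  P_left : s.P = Q.map a
  P_right : t.P = Q.map b
  center_left : s.center = a i
  center_right : t.center = b i
  card : s.C.card = t.C.card
  regions : List.Forall₂ (SameRegion (a o).1 (b o).1) s.regions t.regions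

namespace SameType

variable {φ : X → H} {a b : ι → X × ℤˣ}

theorem dist_lt_iff (h : SameType φ a b) (i j k l : ι) :
    ‖φ (a i).1 - φ (a j).1‖ₑ < ‖φ (a k).1 - φ (a l).1‖ₑ ↔
      ‖φ (b i).1 - φ (b j).1‖ₑ < ‖φ (b k).1 - φ (b l).1‖ₑ := by
  rw [← not_le, ← not_le, h.dist_le_iff]

theorem dist_eq_iff (h : SameType φ a b) (i j k l : ι) :
    ‖φ (a i).1 - φ (a j).1‖ₑ = ‖φ (a k).1 - φ (a l).1‖ₑ ↔
      ‖φ (b i).1 - φ (b j).1‖ₑ = ‖φ (b k).1 - φ (b l).1‖ₑ := by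
  rw [le_antisymm_iff, le_antisymm_iff, h.dist_le_iff, h.dist_le_iff]

theorem update_eq (h : SameType φ a b) (Q : Multiset ι) {i : ι} (hi : i ∈ Q) (j : ι) :
    ∃ Q' : Multiset ι, update φ (Q.map a) (a i) ‖φ (a j).1 - φ (a i).1‖ₑ = Q'.map a ∧
      update φ (Q.map b) (b i) ‖φ (b j).1 - φ (b i).1‖ₑ = Q'.map b := by
  classical
  have hpos : 0 < ‖φ (a j).1 - φ (a i).1‖ₑ ↔ 0 < ‖φ (b j).1 - φ (b i).1‖ₑ := by
    simpa using h.dist_lt_iff i i j i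
  by_cases h0 : 0 < ‖φ (a j).1 - φ (a i).1‖ₑ
  · refine ⟨Q.filter fun k => ‖φ (a j).1 - φ (a i).1‖ₑ ≤ ‖φ (a k).1 - φ (a i).1‖ₑ, ?_, ?_⟩
    · rw [update, if_pos h0, Multiset.filter_map]
      congr 1
      exact Multiset.filter_congr fun k _ => by simp [region]
    · rw [update, if_pos (hpos.1 h0), Multiset.filter_map]
      congr 1
      exact Multiset.filter_congr fun k _ => by simp [region, h.dist_le_iff]
  · refine ⟨Q.erase i, ?_, ?_⟩
    · rw [update, if_neg h0, Multiset.map_erase_of_mem _ _ hi]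
    · rw [update, if_neg (fun hb => h0 (hpos.2 hb)), Multiset.map_erase_of_mem _ _ hi]

/-- A finite radius is a distance between two members of the family, so the tests made in a pass are
all comparisons of labels, instances or such distances, with the same outcome for `a` and `b`. The
index `o` is that of a test point, whose membership in the new region is also such a comparison. -/
theorem step (h : SameType φ a b) {o : ι} {Q : Multiset ι} {i : ι} {s t : State X}
    (hst : SameState a b o Q i s t) :
    ((step φ s).P = 0 ∧ (step φ t).P = 0 ∧ (step φ s).C.card = (step φ t).C.card ∧
      List.Forall₂ (SameRegion (a o).1 (b o).1) (step φ s).regions (step φ t).regions) ∨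
    ∃ Q' i', SameState a b o Q' i' (step φ s) (step φ t) := by
  obtain ⟨sP, sC, sc, sR⟩ := s
  obtain ⟨tP, tC, tc, tR⟩ := t
  obtain ⟨hi, rfl, rfl, rfl, rfl, hcard, hreg⟩ := hst
  dsimp only at hcard hreg
  rcases lt_or_ge (radius φ (Q.map a) (a i)) ∞ with hr | hr
  · right
    obtain ⟨z, hz, hstep⟩ := step_of_lt (s := ⟨Q.map a, sC, a i, sR⟩) hr
    dsimp only at hz hstep
    obtain ⟨j, hjQ, rfl⟩ := Multiset.mem_map.1 (Multiset.mem_of_le (update_le _ _ _ _) hz.1.1)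
    have hra : radius φ (Q.map a) (a i) = ‖φ (a j).1 - φ (a i).1‖ₑ := hz.1.2.1.symm
    have hjb : (b j).2 ≠ (b i).2 := by rw [← h.label, ← h.label]; exact hz.1.2.2
    have hrb : radius φ (Q.map b) (b i) = ‖φ (b j).1 - φ (b i).1‖ₑ := by
      refine radius_eq (Multiset.mem_map_of_mem _ hjQ) hjb fun w hw hwc => ?_
      obtain ⟨k, hk, rfl⟩ := Multiset.mem_map.1 hw
      rw [← h.dist_le_iff, ← hra]
      refine le_radius_iff.1 le_rfl _ (Multiset.mem_map_of_mem _ hk) ?_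
      rw [h.label, h.label]; exact hwc
    obtain ⟨Q', hQa, hQb⟩ := h.update_eq Q hi j
    rw [hra, hQa] at hz hstep
    -- `update_eq` does not say that `Q'` keeps the index `j`; the example itself survives, so some
    -- index `j'` in `Q'` carries it.
    obtain ⟨j', hj', hj'j⟩ := Multiset.mem_map.1 hz.1.1
    rw [← hj'j] at hz hstep
    have hz' : IsNextCenter φ (Q'.map b) (b i) ‖φ (b j).1 - φ (b i).1‖ₑ (b j') := by
      refine ⟨⟨Multiset.mem_map_of_mem _ hj', ?_, ?_⟩, fun w hw hwr hwc => ?_⟩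
      · rw [← h.dist_eq_iff, hj'j]
      · rw [← h.label, ← h.label]; exact hz.1.2.2
      · obtain ⟨k, hk, rfl⟩ := Multiset.mem_map.1 hw
        rw [← h.le_iff]
        refine hz.2 _ (Multiset.mem_map_of_mem _ hk) ?_ ?_
        · rw [hj'j, h.dist_eq_iff]; exact hwr
        · rw [h.label, h.label]; exact hwc
    have hstep' : GEM.step φ ⟨Q.map b, tC, b i, tR⟩ = ⟨Q'.map b, b j' ::ₘ tC, b j',
        tR ++ [(region φ (b i) ‖φ (b j).1 - φ (b i).1‖ₑ, (b i).2)]⟩ := by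
      have : ‖φ (b j).1 - φ (b i).1‖ₑ < ∞ := enorm_lt_top
      simp only [GEM.step, hrb, if_pos this, hQb, nextCenter_eq hz']
    rw [hstep, hstep']
    refine ⟨Q', j', hj', rfl, rfl, rfl, rfl, by simp [hcard], ?_⟩
    refine List.rel_append hreg (List.Forall₂.cons ⟨?_, h.label i⟩ List.Forall₂.nil)
    rw [hj'j]
    exact h.dist_lt_iff o i j i
  · left
    rw [top_le_iff] at hr
    have hrb : radius φ (Q.map b) (b i) = ∞ := by
      rw [radius_eq_top_iff] at hr ⊢
      intro w hw
      obtain ⟨k, hk, rfl⟩ := Multiset.mem_map.1 hw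
      rw [← h.label, ← h.label]
      exact hr _ (Multiset.mem_map_of_mem _ hk)
    rw [step_of_eq_top (s := ⟨Q.map a, sC, a i, sR⟩) hr,
      step_of_eq_top (s := ⟨Q.map b, tC, b i, tR⟩) hrb]
    exact ⟨rfl, rfl, hcard, List.rel_append hreg
      (List.Forall₂.cons ⟨by simp, h.label i⟩ List.Forall₂.nil)⟩

theorem loop_regions (h : SameType φ a b) {o : ι} (d n : ℕ) :
    ∀ {Q : Multiset ι} {i : ι} {s t : State X}, SameState a b o Q i s t →
      List.Forall₂ (SameRegion (a o).1 (b o).1) (loop φ d n s).regions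
        (loop φ d n t).regions := by
  induction n with
  | zero => exact fun hst => hst.regions
  | succ n ih =>
    intro Q i s t hst
    rcases h.step hst with ⟨h1, h2, -, h4⟩ | ⟨Q', i', hst'⟩
    · simpa only [loop, h1, h2, or_true, if_true] using h4
    · have hne : Q' ≠ 0 := fun h => by simpa [h] using hst'.mem
      have h1 : (GEM.step φ s).P ≠ 0 := by rw [hst'.P_left]; simpa using hne
      have h2 : (GEM.step φ t).P ≠ 0 := by rw [hst'.P_right]; simpa using hne
      simp only [loop, h1, h2, or_false, hst'.card]
      split_ifs
      exacts [hst'.regions, ih hst']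

theorem loss_predictor_eq (h : SameType φ a b) (o i : ι) (Q : Multiset ι) (d : ℕ) :
    loss (predictor φ (a i) d (Q.map a)) (a o) = loss (predictor φ (b i) d (Q.map b)) (b o) := by
  classical
  have hreg := h.loop_regions (o := o) d d (Q := i ::ₘ Q) (i := i)
    (s := ⟨a i ::ₘ Q.map a, 0, a i, []⟩) (t := ⟨b i ::ₘ Q.map b, 0, b i, []⟩)
    ⟨Multiset.mem_cons_self _ _, by simp, by simp, rfl, rfl, rfl, List.Forall₂.nil⟩
  have hpred : predictor φ (a i) d (Q.map a) (a o).1 = predictor φ (b i) d (Q.map b) (b o).1 := by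
    unfold predictor run
    revert hreg
    generalize (loop φ d d ⟨a i ::ₘ Q.map a, 0, a i, []⟩).regions = l
    generalize (loop φ d d ⟨b i ::ₘ Q.map b, 0, b i, []⟩).regions = l'
    intro hreg
    induction hreg with
    | nil => rfl
    | @cons R T l l' hRT _ ih =>
      by_cases hR : (a o).1 ∈ R.1
      · simp [hR, hRT.1.1 hR, hRT.2]
      · simpa [hR, mt hRT.1.2 hR] using ih
  simp only [loss, hpred, h.label o]

end SameType

/-- The bits on which the output of the algorithm depends. -/
def comparisons (φ : X → H) (a : ι → X × ℤˣ) :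
    (ι → ℤˣ) × (ι → ι → Prop) × (ι → ι → ι → ι → Prop) :=
  (fun i => (a i).2, fun i j => (a i).1 ≤ (a j).1,
    fun i j k l => ‖φ (a i).1 - φ (a j).1‖ₑ ≤ ‖φ (a k).1 - φ (a l).1‖ₑ)

theorem SameType.of_comparisons_eq {φ : X → H} {a b : ι → X × ℤˣ}
    (h : comparisons φ a = comparisons φ b) : SameType φ a b := by
  simp only [comparisons, Prod.mk.injEq, funext_iff, eq_iff_iff] at h
  exact ⟨h.1, h.2.1, h.2.2⟩

variable [MeasurableSpace X]

theorem measurable_comparisons {φ : X → H}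
    (hφ : Measurable fun p : X × X => ‖φ p.1 - φ p.2‖)
    (hle : MeasurableSet {p : X × X | p.1 ≤ p.2}) :
    Measurable (comparisons φ : (ι → X × ℤˣ) → _) := by
  have hfst : ∀ i, Measurable fun a : ι → X × ℤˣ => (a i).1 := fun i => by fun_prop
  have hd : ∀ i j, Measurable fun a : ι → X × ℤˣ => ‖φ (a i).1 - φ (a j).1‖ₑ := by
    intro i j
    simp only [← ofReal_norm]
    exact ENNReal.measurable_ofReal.comp (hφ.comp ((hfst i).prodMk (hfst j)))
  refine Measurable.prodMk ?_ (Measurable.prodMk ?_ ?_)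
  · fun_prop
  · refine measurable_pi_lambda _ fun i => measurable_pi_lambda _ fun j => ?_
    exact measurableSet_setOfPred.1 (hle.preimage ((hfst i).prodMk (hfst j)))
  · refine measurable_pi_lambda _ fun i => measurable_pi_lambda _ fun j =>
      measurable_pi_lambda _ fun k => measurable_pi_lambda _ fun l => ?_
    exact measurableSet_setOfPred.1 (measurableSet_le (hd i j) (hd k l))

/-- The set of the pairs of a training sample and an example that the resulting predictor
misclassifies is measurable. -/
theorem measurableSet_loss_predictor [Fintype κ] {φ : X → H}
    (hφ : Measurable fun p : X × X => ‖φ p.1 - φ p.2‖)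
    (hle : MeasurableSet {p : X × X | p.1 ≤ p.2}) (zbar : X × ℤˣ) (d : ℕ) :
    MeasurableSet {p : (κ → X × ℤˣ) × (X × ℤˣ) |
      loss (predictor φ zbar d (Multiset.map p.1 Finset.univ.val)) p.2 = 1} := by
  -- One family collects all the points that the algorithm compares: `none` is the test example,
  -- `some none` the initial center, and the remaining indices the sample.
  let fam : (κ → X × ℤˣ) × (X × ℤˣ) → Option (Option κ) → X × ℤˣ :=
    fun p o => o.elim p.2 fun o => o.elim zbar p.1
  have hfam : Measurable fam := by
    refine measurable_pi_lambda _ fun o => ?_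
    rcases o with _ | _ | k
    · exact measurable_snd
    · exact measurable_const
    · exact (measurable_pi_apply k).comp measurable_fst
  set E := {p : (κ → X × ℤˣ) × (X × ℤˣ) |
      loss (predictor φ zbar d (Multiset.map p.1 Finset.univ.val)) p.2 = 1} with hE
  -- `E` is a union of fibres of the comparison map, whose target is finite with measurable
  -- singletons.
  have hpre : E = (comparisons φ ∘ fam) ⁻¹' ((comparisons φ ∘ fam) '' E) := by
    refine (subset_preimage_image _ _).antisymm fun p hp => ?_
    obtain ⟨q, hq, hqp⟩ := hp
    have := (SameType.of_comparisons_eq hqp).loss_predictor_eq none (some none)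
      (Finset.univ.val.map fun k : κ => some (some k)) d
    simp only [Multiset.map_map, Function.comp_def] at this
    exact this.symm.trans hq
  have : MeasurableSingletonClass ℤˣ := measurableSingletonClass_intUnits
  rw [hpre]
  exact ((measurable_comparisons hφ hle).comp hfam) (Set.toFinite _).measurableSet

end Measurability

/-! ### Normalized hold-out indicators -/

section HoldOut

variable {Z κ : Type*} [MeasurableSpace Z] [Fintype κ]

/-- The indicator of the event that all the examples with index outside `p` fall in the section of
`G` at the examples with index in `p`, divided by its conditional probability. -/
noncomputable def holdOut (D : Measure Z) (p : κ → Prop) [DecidablePred p]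
    (G : Set (({i // p i} → Z) × Z)) (s : κ → Z) : ℝ≥0∞ :=
  {s : κ → Z | ∀ j : {i // ¬p i}, ((fun i : {i // p i} => s i), s j) ∈ G}.indicator
    (fun s => (D (Prod.mk (fun i : {i // p i} => s i) ⁻¹' G) ^ Fintype.card {i // ¬p i})⁻¹) s

variable (D : Measure Z) [IsProbabilityMeasure D] (p : κ → Prop) [DecidablePred p]
  {G : Set (({i // p i} → Z) × Z)}

theorem measurable_holdOut (hG : MeasurableSet G) : Measurable (holdOut D p G) := by
  have hres : Measurable fun s : κ → Z => fun i : {i // p i} => s i :=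
    measurable_pi_lambda _ fun i => measurable_pi_apply _
  refine Measurable.indicator ?_ ?_
  · exact (((measurable_measure_prodMk_left hG).comp hres).pow_const _).inv
  · rw [ofPred_forall]
    exact MeasurableSet.iInter fun j => hG.preimage (hres.prodMk (measurable_pi_apply _))

/-- By Fubini: given the examples in `p`, the others are independent with law `D`, so the event has
exactly the conditional probability by which it is divided. Only `≤` holds in general, since that
probability may be zero. -/
theorem lintegral_holdOut_le (hG : MeasurableSet G) :
    ∫⁻ s, holdOut D p G s ∂(Measure.pi fun _ : κ => D) ≤ 1 := by
  classical
  set B : Set (({i // p i} → Z) × ({i // ¬p i} → Z)) := {x | ∀ j, (x.1, x.2 j) ∈ G} with hB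
  set F : ({i // p i} → Z) × ({i // ¬p i} → Z) → ℝ≥0∞ := B.indicator
    fun x => (D (Prod.mk x.1 ⁻¹' G) ^ Fintype.card {i // ¬p i})⁻¹ with hF
  have hFm : Measurable F := by
    refine Measurable.indicator ?_ ?_
    · exact (((measurable_measure_prodMk_left hG).comp measurable_fst).pow_const _).inv
    · rw [hB, ofPred_forall]
      exact MeasurableSet.iInter fun j =>
        hG.preimage (measurable_fst.prodMk ((measurable_pi_apply j).comp measurable_snd))
  have hmp := measurePreserving_piEquivPiSubtypeProd (fun _ : κ => D) p
  have hcomp : ∀ s, holdOut D p G s =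
      F (MeasurableEquiv.piEquivPiSubtypeProd (fun _ : κ => Z) p s) := fun s => rfl
  simp_rw [hcomp]
  rw [hmp.lintegral_comp hFm, lintegral_prod _ hFm.aemeasurable]
  have hinner : ∀ u, ∫⁻ v, F (u, v) ∂(Measure.pi fun _ : {i // ¬p i} => D) ≤ 1 := by
    intro u
    have hset : MeasurableSet (univ.pi fun _ : {i // ¬p i} => Prod.mk u ⁻¹' G) :=
      MeasurableSet.univ_pi fun _ => measurable_prodMk_left hG
    have hFu : ∀ v, F (u, v) = (univ.pi fun _ : {i // ¬p i} => Prod.mk u ⁻¹' G).indicator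
        (fun _ => (D (Prod.mk u ⁻¹' G) ^ Fintype.card {i // ¬p i})⁻¹) v := by
      intro v
      simp [hF, hB, indicator]
    simp_rw [hFu]
    rw [lintegral_indicator_const hset, Measure.pi_pi, Finset.prod_const, Finset.card_univ, mul_comm]
    exact ENNReal.mul_inv_le_one _
  calc _ ≤ ∫⁻ _, 1 ∂(Measure.pi fun _ : {i // p i} => D) := lintegral_mono hinner
    _ = 1 := by simp

end HoldOut

/-! ### Index sets of the compression and their supersets -/

section Counting

variable {α κ : Type*}

/-- The compression is a multiset of values, whereas the hold-out argument needs indices. When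
examples repeat, any choice of copies will do. -/
theorem exists_finset_map_eq_of_le [Fintype κ] {s : κ → α} {C : Multiset α}
    (h : C ≤ Finset.univ.val.map s) : ∃ I : Finset κ, I.val.map s = C := by
  obtain ⟨T, hT, hTC⟩ : ∃ T ≤ (Finset.univ : Finset κ).val, T.map s = C := by
    revert h
    generalize (Finset.univ : Finset κ).val = U
    refine Quotient.inductionOn₂ C U fun c u h => ?_
    obtain ⟨l, hlc, hl⟩ := Multiset.coe_le.1 h
    obtain ⟨v, hv, rfl⟩ := List.sublist_map_iff.1 hl
    exact ⟨v, hv.subperm, Quot.sound hlc⟩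
  exact ⟨⟨T, Multiset.nodup_of_le hT Finset.univ.nodup⟩, hTC⟩

theorem choose_le_card_filter_subset [Fintype κ] [DecidableEq κ] (I : Finset κ) {m : ℕ}
    (hm : I.card ≤ m) : (Fintype.card κ - I.card).choose (m - I.card) ≤
      ((Finset.powersetCard m Finset.univ).filter (I ⊆ ·)).card := by
  rw [← Finset.card_compl, ← Finset.card_powersetCard]
  refine Finset.card_le_card_of_injOn (I ∪ ·) ?_ ?_
  · intro K hK
    obtain ⟨hKI, hKc⟩ := Finset.mem_powersetCard.1 hK
    have hdisj : Disjoint I K := Finset.disjoint_left.2 fun x hx hxK =>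
      Finset.mem_compl.1 (hKI hxK) hx
    simp only [Finset.coe_filter, Finset.mem_powersetCard, Finset.subset_univ, true_and,
      mem_ofPred_eq, Finset.card_union_of_disjoint hdisj, Finset.subset_union_left, and_true]
    omega
  · intro K hK L hL hKL
    have key : ∀ {M : Finset κ}, M ∈ Finset.powersetCard (m - I.card) Iᶜ → (I ∪ M) \ I = M := by
      intro M hM
      have := (Finset.mem_powersetCard.1 hM).1
      rw [Finset.union_sdiff_left, Finset.sdiff_eq_self_iff_disjoint]
      exact Finset.disjoint_left.2 fun x hx hxI => Finset.mem_compl.1 (this hx) hxI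
    rw [← key hK, ← key hL]
    exact congrArg (· \ I) hKL

end Counting

/-! ### Binomial ratios and monotonicity of the bounds -/

section Bounds

/-- Both sides are the proportion, among the `m`-subsets of an `N`-set, of those that contain a
given `k`-subset. This is how the coefficients of `Psi` arise from counting. -/
theorem choose_div_choose_eq {N m k : ℕ} (hkm : k ≤ m) (hmN : m ≤ N) :
    (m.choose k : ℝ) / N.choose k = (N - k).choose (m - k) / N.choose m := by
  have h1 : (0 : ℝ) < N.choose k := by exact_mod_cast Nat.choose_pos (hkm.trans hmN)
  have h2 : (0 : ℝ) < N.choose m := by exact_mod_cast Nat.choose_pos hmN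
  rw [div_eq_div_iff h1.ne' h2.ne']
  have := Nat.choose_mul (n := N) hkm
  rw [mul_comm, mul_comm ((N - k).choose (m - k) : ℝ)]
  exact_mod_cast this

/-- Passing from `k` to `k + 1` multiplies the ratio by `(m - k) / (N - k) ≤ 1`. -/
theorem choose_succ_div_choose_succ_le {N m k : ℕ} (hmN : m ≤ N) (hk : k < N) :
    (m.choose (k + 1) : ℝ) / N.choose (k + 1) ≤ m.choose k / N.choose k := by
  have h1 : (0 : ℝ) < N.choose k := by exact_mod_cast Nat.choose_pos hk.le
  have h2 : (0 : ℝ) < N.choose (k + 1) := by exact_mod_cast Nat.choose_pos hk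
  rw [div_le_div_iff₀ h2 h1]
  have key : m.choose (k + 1) * N.choose k ≤ m.choose k * N.choose (k + 1) := by
    refine Nat.le_of_mul_le_mul_right ?_ k.succ_pos
    calc m.choose (k + 1) * N.choose k * (k + 1)
        = m.choose k * (m - k) * N.choose k := by rw [← Nat.choose_succ_right_eq]; ring
      _ ≤ m.choose k * (N - k) * N.choose k := by gcongr
      _ = m.choose k * N.choose (k + 1) * (k + 1) := by
          rw [mul_assoc _ (N.choose (k + 1)), Nat.choose_succ_right_eq]; ring
  exact_mod_cast key

theorem Psi_succ_le {N k : ℕ} {δ α : ℝ} (hk : k < N) (hδ : 0 < δ) (hα : α < 1) :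
    Psi N δ (k + 1) α ≤ Psi N δ k α := by
  have hα' : 0 < 1 - α := by linarith
  unfold Psi
  refine mul_le_mul_of_nonneg_left ?_ (by positivity)
  refine (Finset.sum_le_sum fun m hm => mul_le_mul_of_nonneg_right
    (choose_succ_div_choose_succ_le (Finset.mem_Ico.1 hm).2.le hk) (by positivity)).trans ?_
  exact Finset.sum_le_sum_of_subset_of_nonneg (Finset.Ico_subset_Ico_left k.le_succ)
    fun _ _ _ => by positivity

/-- `Psi` increases with `α` and decreases with `k`, so its crossing of the level `1` moves to the
right as `k` grows. -/
theorem eps_mono {N : ℕ} {δ : ℝ} (h0 : 0 < δ) (h1 : δ < 1) : Monotone (eps N δ) := by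
  refine monotone_nat_of_le_succ fun k => ?_
  rcases lt_or_ge (k + 1) N with hk | hk
  · have hk' : k < N := (Nat.lt_succ_self k).trans hk
    obtain ⟨ha, hPa⟩ := eps_spec hk' h0 h1
    obtain ⟨hb, hPb⟩ := eps_spec hk h0 h1
    by_contra! hlt
    have := Psi_strictMonoOn hk' h0 hb.2 ha.2 hlt
    have := Psi_succ_le hk' h0 hb.2
    linarith
  · have hsucc : eps N δ (k + 1) = 1 := if_neg hk.not_gt
    rw [hsucc]
    rcases lt_or_ge k N with hk' | hk'
    · exact (eps_spec hk' h0 h1).1.2.le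
    · exact (if_neg hk'.not_gt : eps N δ k = 1).le

end Bounds

/-! ### The error statistic and the risk -/

section Risk

variable {X H κ : Type*} [NormedAddCommGroup H] [LinearOrder X]

/-- The examples that the predictor trained on a given sample does not misclassify. -/
def correct (φ : X → H) (zbar : X × ℤˣ) (d : ℕ) (κ : Type*) [Fintype κ] :
    Set ((κ → X × ℤˣ) × (X × ℤˣ)) :=
  {p | loss (predictor φ zbar d (Multiset.map p.1 Finset.univ.val)) p.2 = 1}ᶜ

theorem map_coe_univ_val {α κ : Type*} (J : Finset κ) (s : κ → α) :
    Multiset.map (fun i : {i // i ∈ J} => s i) Finset.univ.val = J.val.map s := by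
  rw [Finset.univ_eq_attach, Finset.attach_val]
  exact Multiset.attach_map_val' J.val s

variable {φ : X → H} {zbar : X × ℤˣ} {d : ℕ} [Fintype κ]

theorem predictor_sub_eq {s : κ → X × ℤˣ} {I J : Finset κ}
    (hI : I.val.map s = compression φ zbar d (Finset.univ.val.map s)) (hIJ : I ⊆ J) :
    predictor φ zbar d (Multiset.map (fun i : {i // i ∈ J} => s i) Finset.univ.val) =
      predictor φ zbar d (Finset.univ.val.map s) := by
  rw [map_coe_univ_val]
  refine predictor_eq_of_le (Multiset.map_le_map (Finset.val_le_iff.2 J.subset_univ)) ?_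
  rw [← hI]
  exact Multiset.map_le_map (Finset.val_le_iff.2 hIJ)

theorem prodMk_preimage_correct_sub {s : κ → X × ℤˣ} {I J : Finset κ}
    (hI : I.val.map s = compression φ zbar d (Finset.univ.val.map s)) (hIJ : I ⊆ J) :
    Prod.mk (fun i : {i // i ∈ J} => s i) ⁻¹' correct φ zbar d {i // i ∈ J} =
      {z | loss (predictor φ zbar d (Finset.univ.val.map s)) z = 1}ᶜ := by
  rw [correct, preimage_compl, preimage_ofPred_eq]
  simp only [predictor_sub_eq hI hIJ]

variable [MeasurableSpace X]

/-- Both properties of the compression meet here. As `I ⊆ J`, training on `J` gives the full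
predictor; an index outside `J` is outside `I`, so its example is a surplus copy and is not
misclassified. The indicator is therefore `1`. -/
theorem holdOut_correct_eq [DecidableEq κ] (D : Measure (X × ℤˣ)) {s : κ → X × ℤˣ} {I J : Finset κ}
    (hI : I.val.map s = compression φ zbar d (Finset.univ.val.map s)) (hIJ : I ⊆ J) :
    holdOut D (· ∈ J) (correct φ zbar d {i // i ∈ J}) s =
      (D {z | loss (predictor φ zbar d (Finset.univ.val.map s)) z = 1}ᶜ ^
        (Fintype.card κ - J.card))⁻¹ := by
  rw [holdOut, indicator_of_mem]
  · rw [prodMk_preimage_correct_sub hI hIJ, Fintype.card_subtype_compl, Fintype.card_coe]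
  · rintro ⟨j, hj⟩
    have : s j ∈ Prod.mk (fun i : {i // i ∈ J} => s i) ⁻¹' correct φ zbar d {i // i ∈ J} := by
      rw [prodMk_preimage_correct_sub hI hIJ]
      refine loss_predictor_ne_one ?_
      rw [← hI, ← Multiset.map_cons]
      refine Multiset.map_le_map ?_
      have hjI : j ∉ I := fun h => hj (hIJ h)
      rw [← Finset.cons_val hjI]
      exact Finset.val_le_iff.2 (Finset.subset_univ _)
    exact this

theorem measurableSet_correct (hφ : Measurable fun p : X × X => ‖φ p.1 - φ p.2‖)
    (hle : MeasurableSet {p : X × X | p.1 ≤ p.2}) : MeasurableSet (correct φ zbar d κ) :=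
  (measurableSet_loss_predictor hφ hle zbar d).compl

/-- The average over `m < N` and over the subsamples of size `m` of the normalized indicators of the
event that the predictor trained on the subsample errs on none of the other examples, times `δ`. -/
noncomputable def errorStatistic (φ : X → H) (zbar : X × ℤˣ) (d : ℕ) (D : Measure (X × ℤˣ)) (N : ℕ)
    (δ : ℝ) (s : Fin N → X × ℤˣ) : ℝ≥0∞ :=
  ∑ m ∈ Finset.range N, ENNReal.ofReal (δ / N / N.choose m) *
    ∑ J ∈ Finset.powersetCard m Finset.univ, holdOut D (· ∈ J) (correct φ zbar d {i // i ∈ J}) s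

variable {D : Measure (X × ℤˣ)} [IsProbabilityMeasure D] {N : ℕ} {δ : ℝ}

theorem measurable_errorStatistic (hφ : Measurable fun p : X × X => ‖φ p.1 - φ p.2‖)
    (hle : MeasurableSet {p : X × X | p.1 ≤ p.2}) :
    Measurable (errorStatistic φ zbar d D N δ) :=
  Finset.measurable_fun_sum _ fun _ _ => (Finset.measurable_fun_sum _ fun _ _ =>
    measurable_holdOut D _ (measurableSet_correct hφ hle)).const_mul _

theorem lintegral_errorStatistic_le (hφ : Measurable fun p : X × X => ‖φ p.1 - φ p.2‖)
    (hle : MeasurableSet {p : X × X | p.1 ≤ p.2}) (hδ : 0 < δ) :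
    ∫⁻ s, errorStatistic φ zbar d D N δ s ∂(Measure.pi fun _ => D) ≤ ENNReal.ofReal δ := by
  have hm : ∀ J : Finset (Fin N),
      Measurable (holdOut D (· ∈ J) (correct φ zbar d {i // i ∈ J})) := fun J =>
    measurable_holdOut D _ (measurableSet_correct hφ hle)
  unfold errorStatistic
  have hsm : ∀ m, Measurable fun s => ∑ J ∈ Finset.powersetCard m (Finset.univ : Finset (Fin N)),
      holdOut D (· ∈ J) (correct φ zbar d {i // i ∈ J}) s := fun m =>
    Finset.measurable_fun_sum _ fun J _ => hm J
  rw [lintegral_finsetSum _ fun m _ => (hsm m).const_mul _]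
  calc _ ≤ ∑ m ∈ Finset.range N, ENNReal.ofReal (δ / N) := by
        refine Finset.sum_le_sum fun m hmN => ?_
        rw [lintegral_const_mul _ (hsm m),
          lintegral_finsetSum _ fun J _ => hm J]
        have hsum : ∑ J ∈ Finset.powersetCard m (Finset.univ : Finset (Fin N)),
            ∫⁻ s, holdOut D (· ∈ J) (correct φ zbar d {i // i ∈ J}) s ∂(Measure.pi fun _ => D) ≤
              (N.choose m : ℝ≥0∞) := by
          refine (Finset.sum_le_sum fun J _ =>
            lintegral_holdOut_le D (· ∈ J) (measurableSet_correct hφ hle)).trans ?_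
          simp
        refine (mul_le_mul_right hsum _).trans ?_
        have hpos : (0 : ℝ) < N.choose m := by
          exact_mod_cast Nat.choose_pos (Finset.mem_range.1 hmN).le
        rw [← ENNReal.ofReal_natCast, ← ENNReal.ofReal_mul (by positivity),
          div_mul_cancel₀ _ hpos.ne']
    _ ≤ ENNReal.ofReal δ := by
        rw [Finset.sum_const, Finset.card_range, nsmul_eq_mul, ← ENNReal.ofReal_natCast,
          ← ENNReal.ofReal_mul (by positivity)]
        refine ENNReal.ofReal_le_ofReal ?_
        -- For `N = 0` the sum is empty, and `δ / N` is `0` by convention.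
        rcases eq_or_ne (N : ℝ) 0 with h | h
        · simp [h, hδ.le]
        · rw [mul_div_cancel₀ _ h]

theorem one_le_errorStatistic (hφ : Measurable fun p : X × X => ‖φ p.1 - φ p.2‖)
    (hle : MeasurableSet {p : X × X | p.1 ≤ p.2}) (h0 : 0 < δ) (h1 : δ < 1) (s : Fin N → X × ℤˣ)
    (hs : eps N δ (compression φ zbar d (Finset.univ.val.map s)).card <
      risk D (predictor φ zbar d (Finset.univ.val.map s))) :
    1 ≤ errorStatistic φ zbar d D N δ s := by
  obtain ⟨I, hI⟩ := exists_finset_map_eq_of_le (compression_le φ zbar d (Finset.univ.val.map s))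
  have hcard : (compression φ zbar d (Finset.univ.val.map s)).card = I.card := by
    rw [← hI, Multiset.card_map, Finset.card_def]
  rw [hcard] at hs
  set k := I.card
  set W : Set (X × ℤˣ) := {z | loss (predictor φ zbar d (Finset.univ.val.map s)) z = 1} with hW
  have hWm : MeasurableSet W :=
    measurable_prodMk_left (x := s) (measurableSet_loss_predictor hφ hle zbar d)
  have hrisk : risk D (predictor φ zbar d (Finset.univ.val.map s)) = D.real W := rfl
  rw [hrisk] at hs
  -- For `k ≥ N` the bound is `1`, which no risk exceeds.
  have hk : k < N := by
    by_contra hk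
    rw [eps, if_neg hk] at hs
    exact hs.not_ge measureReal_le_one
  obtain ⟨⟨he0, he1⟩, hPsi⟩ := eps_spec hk h0 h1
  set ε := eps N δ k
  have hD : D Wᶜ ≤ ENNReal.ofReal (1 - ε) := by
    rw [← ofReal_measureReal, probReal_compl_eq_one_sub hWm]
    exact ENNReal.ofReal_le_ofReal (by linarith)
  have hε : 0 < 1 - ε := by linarith
  calc (1 : ℝ≥0∞) = ENNReal.ofReal (Psi N δ k ε) := by rw [hPsi, ENNReal.ofReal_one]
    _ = ∑ m ∈ Finset.Ico k N, ENNReal.ofReal (δ / N / N.choose m) *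
          (((N - k).choose (m - k) : ℝ≥0∞) * (ENNReal.ofReal (1 - ε) ^ (N - m))⁻¹) := by
        unfold Psi
        rw [Finset.mul_sum, ENNReal.ofReal_sum_of_nonneg fun m _ => by positivity]
        refine Finset.sum_congr rfl fun m hm => ?_
        obtain ⟨hkm, hmN⟩ := Finset.mem_Ico.1 hm
        rw [choose_div_choose_eq hkm hmN.le, ← ENNReal.ofReal_pow hε.le,
          ← ENNReal.ofReal_inv_of_pos (pow_pos hε _), ← ENNReal.ofReal_natCast,
          ← ENNReal.ofReal_mul (by positivity), ← ENNReal.ofReal_mul (by positivity)]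
        congr 1
        ring
    -- Keep only the `J` that contain `I`. Each contributes `(D Wᶜ)^(-(N - m))`, and `D Wᶜ ≤ 1 - ε`
    -- because the risk exceeds `ε`.
    _ ≤ ∑ m ∈ Finset.Ico k N, ENNReal.ofReal (δ / N / N.choose m) *
          ∑ J ∈ Finset.powersetCard m Finset.univ,
            holdOut D (· ∈ J) (correct φ zbar d {i // i ∈ J}) s := by
        refine Finset.sum_le_sum fun m hm => mul_le_mul_right ?_ _
        obtain ⟨hkm, -⟩ := Finset.mem_Ico.1 hm
        have hc := choose_le_card_filter_subset I hkm
        rw [Fintype.card_fin] at hc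
        calc ((N - k).choose (m - k) : ℝ≥0∞) * (ENNReal.ofReal (1 - ε) ^ (N - m))⁻¹
            ≤ ∑ J ∈ (Finset.powersetCard m Finset.univ).filter (I ⊆ ·),
              (ENNReal.ofReal (1 - ε) ^ (N - m))⁻¹ := by
              rw [Finset.sum_const, nsmul_eq_mul]
              gcongr
          _ ≤ ∑ J ∈ (Finset.powersetCard m Finset.univ).filter (I ⊆ ·),
              holdOut D (· ∈ J) (correct φ zbar d {i // i ∈ J}) s := by
              refine Finset.sum_le_sum fun J hJ => ?_
              obtain ⟨hJm, hIJ⟩ := Finset.mem_filter.1 hJ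
              rw [holdOut_correct_eq D hI hIJ, Fintype.card_fin, (Finset.mem_powersetCard.1 hJm).2]
              gcongr
          _ ≤ _ := Finset.sum_le_sum_of_subset (Finset.filter_subset _ _)
    _ ≤ errorStatistic φ zbar d D N δ s := by
        refine Finset.sum_le_sum_of_subset fun m hm => ?_
        exact Finset.mem_range.2 (Finset.mem_Ico.1 hm).2

end Risk

end GEM

theorem mainTheorem11
    {X : Type*} [MeasurableSpace X] [LinearOrder X]
    {H : Type*} [NormedAddCommGroup H] [InnerProductSpace ℝ H] [CompleteSpace H]
    (φ : X → H)
    (hφ : Measurable fun p : X × X => ‖φ p.1 - φ p.2‖)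
    (hle : MeasurableSet {p : X × X | p.1 ≤ p.2})
    (zbar : X × ℤˣ) (d : ℕ) (hd : 1 ≤ d)
    {Ω : Type*} [MeasurableSpace Ω] (Pr : Measure Ω) [IsProbabilityMeasure Pr]
    (D : Measure (X × ℤˣ)) [IsProbabilityMeasure D]
    (N : ℕ) (z : Fin N → Ω → X × ℤˣ)
    (hindep : iIndepFun z Pr) (hlaw : ∀ i, HasLaw (z i) D Pr)
    (S : Ω → Multiset (X × ℤˣ))
    (hS : ∀ ω, S ω = Multiset.map (fun i => z i ω) Finset.univ.val)
    (δ : ℝ) (hδ0 : 0 < δ) (hδ1 : δ < 1) :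
    Pr {ω | GEM.eps N δ (GEM.compression φ zbar d (S ω)).card <
        GEM.risk D (GEM.predictor φ zbar d (S ω))} ≤ ENNReal.ofReal δ ∧
    (∀ ω, (GEM.compression φ zbar d (S ω)).card ≤ d ∧
      GEM.eps N δ (GEM.compression φ zbar d (S ω)).card ≤ GEM.eps N δ d) ∧
    Pr {ω | GEM.eps N δ d < GEM.risk D (GEM.predictor φ zbar d (S ω))} ≤ ENNReal.ofReal δ := by
  have hcard : ∀ ω, (GEM.compression φ zbar d (S ω)).card ≤ d ∧
      GEM.eps N δ (GEM.compression φ zbar d (S ω)).card ≤ GEM.eps N δ d := fun ω =>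
    ⟨GEM.card_compression_le φ zbar d (S ω),
      GEM.eps_mono hδ0 hδ1 (GEM.card_compression_le φ zbar d (S ω))⟩
  have hmain : Pr {ω | GEM.eps N δ (GEM.compression φ zbar d (S ω)).card <
      GEM.risk D (GEM.predictor φ zbar d (S ω))} ≤ ENNReal.ofReal δ := by
    have hae : ∀ i, AEMeasurable (z i) Pr := fun i => (hlaw i).aemeasurable
    have hmap : Pr.map (fun ω i => z i ω) = Measure.pi fun _ : Fin N => D := by
      rw [(iIndepFun_iff_map_fun_eq_pi_map hae).1 hindep]
      congr 1
      funext i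
      exact (hlaw i).map_eq
    have haeall : AEMeasurable (fun ω i => z i ω) Pr := aemeasurable_pi_lambda _ hae
    have hmeas := GEM.measurable_errorStatistic (zbar := zbar) (d := d) (D := D) (N := N)
      (δ := δ) hφ hle
    -- The bad event is not shown to be measurable; monotonicity of the outer measure suffices, and
    -- Markov's inequality is applied to the larger event, defined by a measurable statistic.
    calc _ ≤ Pr {ω | 1 ≤ GEM.errorStatistic φ zbar d D N δ fun i => z i ω} := by
          refine measure_mono fun ω hω => ?_
          have hω' : GEM.eps N δ (GEM.compression φ zbar d (S ω)).card <
            GEM.risk D (GEM.predictor φ zbar d (S ω)) := hω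
          rw [hS] at hω'
          exact GEM.one_le_errorStatistic hφ hle hδ0 hδ1 _ hω'
      _ ≤ ∫⁻ ω, GEM.errorStatistic φ zbar d D N δ (fun i => z i ω) ∂Pr := by
          have := mul_meas_ge_le_lintegral₀ (hmeas.comp_aemeasurable haeall) 1
          rwa [one_mul] at this
      _ = ∫⁻ s, GEM.errorStatistic φ zbar d D N δ s ∂(Measure.pi fun _ => D) := by
          rw [← hmap, lintegral_map' hmeas.aemeasurable haeall]
      _ ≤ ENNReal.ofReal δ := GEM.lintegral_errorStatistic_le hφ hle hδ0
  exact ⟨hmain, hcard, (measure_mono fun ω hω => (hcard ω).2.trans_lt hω).trans hmain⟩
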